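/- Let $F\subseteq\mathbb{R}^n$ be a closed, bounded, convex set with $0\in\operatorname{int}F$. Let $\mathcal{G}:\mathbb{R}^m\rightrightarrows\mathbb{R}^n$ be a set-valued mapping whose graph $\operatorname{gph}\mathcal{G}:=\{(x,y)\in\mathbb{R}^m\times\mathbb{R}^n \mid y\in\mathcal{G}(x)\}$ is closed, and let $(\bar x,\bar y)\in\operatorname{gph}\mathcal{G}$. Here $\mathbb{R}^m$ and $\mathbb{R}^n$ carry the Euclidean norm, $\mathbb{R}^m\times\mathbb{R}^n$ carries the sum norm, and $\mathbb{B}$ is the closed unit ball of $\mathbb{R}^n$. Define the minimal time function $\mathcal{T}^F_{\mathcal{G}}:\mathbb{R}^m\times\mathbb{R}^n\to[0,\infty]$ by $$\mathcal{T}^F_{\mathcal{G}}(x,y):=\inf\{t\ge 0 \mid (y+tF)\cap\mathcal{G}(x)\ne\emptyset\},\qquad \inf\emptyset:=\infty.$$ Then the following are equivalent: (i) $\mathcal{T}^F_{\mathcal{G}}$ is Lipschitz continuous around $(\bar x,\bar y)$: there are a neighborhood $U$ of $(\bar x,\bar y)$ and a constant $\ell$ such that $\mathcal{T}^F_{\mathcal{G}}$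 is finite on $U$ and $|\mathcal{T}^F_{\mathcal{G}}(p)-\mathcal{T}^F_{\mathcal{G}}(q)|\le\ell\|p-q\|$ for all $p,q\in U$. (ii) $\mathcal{G}$ is Lipschitz-like (has the Aubin property) around $(\bar x,\bar y)$: there are neighborhoods $V$ of $\bar x$ and $W$ of $\bar y$ and a constant $\ell\ge 0$ such that $\mathcal{G}(x)\cap W\subseteq\mathcal{G}(u)+\ell\|x-u\|\mathbb{B}$ for all $x,u\in V$. -/

import Mathlib

open Topology
open scoped Pointwise

/-- The graph `{(x, y) | y ∈ G x}` of a set-valued mapping `G`. -/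
def setValuedGraph {X Y : Type*} (G : X → Set Y) : Set (X × Y) :=
  {p | p.2 ∈ G p.1}

/-- The minimal time function of the set-valued mapping `G` with dynamics `F`,
`(x, y) ↦ inf {t ≥ 0 | (y + t F) ∩ G x ≠ ∅}`, with values in the extended reals
(the infimum of the empty set is `+∞`). Its domain is the product `X × Y` with the sum norm. -/
noncomputable def minimalTime {X Y : Type*} [NormedAddCommGroup Y] [NormedSpace ℝ Y]
    (F : Set Y) (G : X → Set Y) (p : WithLp 1 (X × Y)) : EReal :=
  sInf ((fun t : ℝ => (t : EReal)) '' {t : ℝ | 0 ≤ t ∧ (({p.snd} + t • F) ∩ G p.fst).Nonempty})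

/-- An extended-real-valued function is Lipschitz continuous around `a` if on some neighborhood
of `a` it is finite and satisfies a Lipschitz estimate. -/
def LipschitzAround {E : Type*} [NormedAddCommGroup E] (ψ : E → EReal) (a : E) : Prop :=
  ∃ ℓ : ℝ, ∃ V ∈ 𝓝 a, (∀ p ∈ V, ψ p ≠ ⊤ ∧ ψ p ≠ ⊥) ∧
    ∀ p ∈ V, ∀ q ∈ V, |(ψ p).toReal - (ψ q).toReal| ≤ ℓ * ‖p - q‖

/-- The Lipschitz-like (Aubin) property of a set-valued mapping around `(a, b)`. -/
def LipschitzLikeAround {X Y : Type*} [NormedAddCommGroup X] [NormedAddCommGroup Y]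
    [NormedSpace ℝ Y] (G : X → Set Y) (a : X) (b : Y) : Prop :=
  ∃ V ∈ 𝓝 a, ∃ W ∈ 𝓝 b, ∃ ℓ : ℝ, 0 ≤ ℓ ∧
    ∀ x ∈ V, ∀ u ∈ V, G x ∩ W ⊆ G u + (ℓ * ‖x - u‖) • Metric.closedBall (0 : Y) 1

/-!
Write `T` for the minimal time function. Since `F` is bounded and contains a ball
`closedBall 0 r` around the origin, travel times are comparable to distances: a point of `G x`
reached from `y` in time `t` is at distance at most `R * t` from `y`, and, because `F` is convex, an
admissible motion lasting `t` whose endpoint misses the target by at most `r * s` can be corrected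
into one lasting `t + s` (`add_mem_reachTimes`).

If `T` is Lipschitz near `(x̄, ȳ)`, then for `y ∈ G x` near `ȳ` one has `T (x, y) = 0`, hence
`T (u, y) ≤ ℓ ‖x - u‖`, and `G u` has a point within distance of order `‖x - u‖` of `y`.

Conversely, the Lipschitz-like property applied to `ȳ ∈ G x̄` shows that `T` is small near `(x̄, ȳ)`.
A near-optimal motion from `y` therefore ends at a point of `G x` close to `ȳ`, where the
Lipschitz-like property applies again: `G u` has a point within `ℓ ‖x - u‖` of that endpoint. The
correction lemma then gives `T (u, v) ≤ T (x, y) + (ℓ ‖x - u‖ + ‖y - v‖) / r`.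

Neither direction needs the infimum defining `T` to be attained.
-/

/-- The admissible times for reaching the set `A` from `y` with dynamics `F`; the minimal time
function at `(x, y)` is the infimum of `reachTimes F (G x) y`. -/
def reachTimes {Y : Type*} [NormedAddCommGroup Y] [NormedSpace ℝ Y]
    (F A : Set Y) (y : Y) : Set ℝ :=
  {t | 0 ≤ t ∧ ∃ f ∈ F, y + t • f ∈ A}

section

variable {X Y : Type*} [NormedAddCommGroup Y] [NormedSpace ℝ Y] {F A : Set Y} {G : X → Set Y}

theorem minimalTime_eq (p : WithLp 1 (X × Y)) :
    minimalTime F G p = sInf ((fun t : ℝ => (t : EReal)) '' reachTimes F (G p.fst) p.snd) := by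
  have h : {t : ℝ | 0 ≤ t ∧ (({p.snd} + t • F) ∩ G p.fst).Nonempty} =
      reachTimes F (G p.fst) p.snd := by
    ext t
    simp only [reachTimes, Set.mem_ofPred_eq, Set.singleton_add]
    refine and_congr_right fun _ => ⟨?_, ?_⟩
    · rintro ⟨_, ⟨_, ⟨f, hf, rfl⟩, rfl⟩, hz⟩
      exact ⟨f, hf, hz⟩
    · rintro ⟨f, hf, hz⟩
      exact ⟨_, ⟨_, ⟨f, hf, rfl⟩, rfl⟩, hz⟩
  rw [minimalTime, h]

theorem minimalTime_nonneg (p : WithLp 1 (X × Y)) : 0 ≤ minimalTime F G p := by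
  rw [minimalTime_eq]
  refine le_sInf ?_
  rintro _ ⟨t, ht, rfl⟩
  exact EReal.coe_nonneg.2 ht.1

theorem minimalTime_ne_bot (p : WithLp 1 (X × Y)) : minimalTime F G p ≠ ⊥ :=
  fun h => absurd (minimalTime_nonneg (F := F) (G := G) p) (by simp [h])

theorem minimalTime_le {p : WithLp 1 (X × Y)} {t : ℝ}
    (ht : t ∈ reachTimes F (G p.fst) p.snd) : minimalTime F G p ≤ t := by
  rw [minimalTime_eq]
  exact sInf_le ⟨t, ht, rfl⟩

theorem minimalTime_ne_top {p : WithLp 1 (X × Y)} {t : ℝ}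
    (ht : t ∈ reachTimes F (G p.fst) p.snd) : minimalTime F G p ≠ ⊤ :=
  ((minimalTime_le ht).trans_lt (EReal.coe_lt_top t)).ne

theorem toReal_minimalTime_le {p : WithLp 1 (X × Y)} {t : ℝ}
    (ht : t ∈ reachTimes F (G p.fst) p.snd) : (minimalTime F G p).toReal ≤ t := by
  have h := minimalTime_le ht
  rwa [← EReal.coe_toReal (minimalTime_ne_top ht) (minimalTime_ne_bot p), EReal.coe_le_coe_iff] at h

theorem exists_mem_reachTimes_lt {p : WithLp 1 (X × Y)} {c : ℝ} (hp : minimalTime F G p ≠ ⊤)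
    (hc : (minimalTime F G p).toReal < c) : ∃ t ∈ reachTimes F (G p.fst) p.snd, t < c := by
  have h : minimalTime F G p < c := by
    rwa [← EReal.coe_toReal hp (minimalTime_ne_bot p), EReal.coe_lt_coe_iff]
  rw [minimalTime_eq, sInf_lt_iff] at h
  obtain ⟨_, ⟨t, ht, rfl⟩, htc⟩ := h
  exact ⟨t, ht, EReal.coe_lt_coe_iff.1 htc⟩

/-- An admissible motion lasting `t` whose endpoint is within `r * s` of `z ∈ A` can be replaced by
one lasting `t + s` that ends at `z`. By convexity `t • F + s • F = (t + s) • F`, and `s • F`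
contains the ball of radius `r * s`. -/
theorem add_mem_reachTimes (hF : Convex ℝ F) {r : ℝ} (hr : 0 ≤ r)
    (hrF : Metric.closedBall 0 r ⊆ F) {t s : ℝ} (ht : 0 ≤ t) (hs : 0 ≤ s) {f y z : Y}
    (hf : f ∈ F) (hz : z ∈ A) (hzy : ‖z - (y + t • f)‖ ≤ r * s) : t + s ∈ reachTimes F A y := by
  have hmem : z - (y + t • f) ∈ s • F := by
    refine Set.smul_set_mono hrF ?_
    rw [smul_closedBall s 0 hr, smul_zero, Real.norm_of_nonneg hs, mem_closedBall_zero_iff,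
      mul_comm]
    exact hzy
  have hsum : t • f + (z - (y + t • f)) ∈ (t + s) • F := by
    rw [hF.add_smul ht hs]
    exact Set.add_mem_add (Set.smul_mem_smul_set hf) hmem
  obtain ⟨g, hg, hgz⟩ := hsum
  have hend : y + (t + s) • g = z := by
    have hgz' : (t + s) • g = t • f + (z - (y + t • f)) := hgz
    rw [hgz']
    abel
  exact ⟨add_nonneg ht hs, g, hg, hend ▸ hz⟩

/-- `LipschitzLikeAround` with the scaled unit ball written out as a norm bound. -/
theorem lipschitzLikeAround_iff [NormedAddCommGroup X] {a : X} {b : Y} :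
    LipschitzLikeAround G a b ↔ ∃ V ∈ 𝓝 a, ∃ W ∈ 𝓝 b, ∃ ℓ : ℝ, 0 ≤ ℓ ∧
      ∀ x ∈ V, ∀ u ∈ V, ∀ y ∈ G x, y ∈ W → ∃ z ∈ G u, ‖y - z‖ ≤ ℓ * ‖x - u‖ := by
  unfold LipschitzLikeAround
  refine exists_congr fun V => and_congr_right fun _ => exists_congr fun W =>
    and_congr_right fun _ => exists_congr fun ℓ => and_congr_right fun hℓ =>
    forall₂_congr fun x _ => forall₂_congr fun u _ => ?_
  rw [smul_unitClosedBall, Real.norm_of_nonneg (by positivity)]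
  constructor
  · intro h y hy hW
    obtain ⟨z, hz, w, hw, rfl⟩ := h ⟨hy, hW⟩
    exact ⟨z, hz, by simpa using hw⟩
  · rintro h y ⟨hy, hW⟩
    obtain ⟨z, hz, hyz⟩ := h y hy hW
    exact ⟨z, hz, y - z, by simpa using hyz, by simp⟩

theorem LipschitzAround.lipschitzLikeAround [NormedAddCommGroup X] (hFbdd : Bornology.IsBounded F)
    (hF0 : (0 : Y) ∈ F) {a : X} {b : Y}
    (h : LipschitzAround (minimalTime F G) (WithLp.toLp 1 (a, b))) :
    LipschitzLikeAround G a b := by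
  obtain ⟨ℓ, U, hU, hfin, hlip⟩ := h
  obtain ⟨R, hR, hFR⟩ := hFbdd.exists_pos_norm_le
  obtain ⟨δ, hδ, hδU⟩ := Metric.mem_nhds_iff.1 hU
  have hmemU : ∀ x ∈ Metric.ball a (δ / 2), ∀ y ∈ Metric.ball b (δ / 2),
      WithLp.toLp 1 (x, y) ∈ U := by
    intro x hx y hy
    refine hδU ?_
    rw [mem_ball_iff_norm] at *
    rw [WithLp.prod_norm_eq_of_L1]
    change ‖x - a‖ + ‖y - b‖ < δ
    linarith
  refine lipschitzLikeAround_iff.2 ⟨_, Metric.ball_mem_nhds a (half_pos hδ), _,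
    Metric.ball_mem_nhds b (half_pos hδ), R * (|ℓ| + 1), by positivity, ?_⟩
  intro x hx u hu y hy hyb
  rcases eq_or_ne x u with rfl | hxu
  · exact ⟨y, hy, by simp⟩
  have hpos : 0 < ‖x - u‖ := norm_pos_iff.2 (sub_ne_zero.2 hxu)
  have hx0 : (minimalTime F G (WithLp.toLp 1 (x, y))).toReal ≤ 0 :=
    toReal_minimalTime_le ⟨le_rfl, 0, hF0, by simpa using hy⟩
  have hle := hlip _ (hmemU u hu y hyb) _ (hmemU x hx y hyb)
  have hnorm : ‖WithLp.toLp 1 (u, y) - WithLp.toLp 1 (x, y)‖ = ‖x - u‖ := by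
    rw [WithLp.prod_norm_eq_of_L1]
    simp [norm_sub_rev]
  rw [hnorm] at hle
  -- The slack `‖x - u‖ > 0` is what makes attainment of the infimum unnecessary.
  have hlt : (minimalTime F G (WithLp.toLp 1 (u, y))).toReal < (|ℓ| + 1) * ‖x - u‖ := by
    have h1 := (le_abs_self _).trans hle
    have h2 := mul_le_mul_of_nonneg_right (le_abs_self ℓ) hpos.le
    linarith
  obtain ⟨t, ⟨ht, f, hf, hz⟩, htlt⟩ := exists_mem_reachTimes_lt (hfin _ (hmemU u hu y hyb)).1 hlt
  refine ⟨_, hz, ?_⟩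
  calc ‖y - (y + t • f)‖ = t * ‖f‖ := by simp [norm_smul, abs_of_nonneg ht]
    _ ≤ ((|ℓ| + 1) * ‖x - u‖) * R :=
        mul_le_mul htlt.le (hFR f hf) (norm_nonneg _) (by positivity)
    _ = R * (|ℓ| + 1) * ‖x - u‖ := by ring

theorem LipschitzLikeAround.lipschitzAround [NormedAddCommGroup X] (hFbdd : Bornology.IsBounded F)
    (hF : Convex ℝ F) (hF0 : (0 : Y) ∈ interior F) {a : X} {b : Y} (hab : b ∈ G a)
    (h : LipschitzLikeAround G a b) :
    LipschitzAround (minimalTime F G) (WithLp.toLp 1 (a, b)) := by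
  obtain ⟨V, hV, W, hW, ℓ, hℓ, hGl⟩ := lipschitzLikeAround_iff.1 h
  obtain ⟨R, hR, hFR⟩ := hFbdd.exists_pos_norm_le
  obtain ⟨r, hr, hrF⟩ := Metric.nhds_basis_closedBall.mem_iff.1 (mem_interior_iff_mem_nhds.1 hF0)
  obtain ⟨δ₁, hδ₁, hV⟩ := Metric.mem_nhds_iff.1 hV
  obtain ⟨δ₂, hδ₂, hW⟩ := Metric.mem_nhds_iff.1 hW
  -- On the ball of radius `η` the minimal time is below `c * η`, so motions starting there and
  -- lasting less than `c * η` end within `(1 + c * R) * η ≤ δ₂` of `b`.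
  set c : ℝ := (ℓ + 2) / r with hc
  have hcpos : 0 < c := by positivity
  set η : ℝ := min δ₁ (δ₂ / (1 + c * R)) with hη
  have hηpos : 0 < η := lt_min hδ₁ (by positivity)
  have hηδ : (1 + c * R) * η ≤ δ₂ := by
    have h1 : η ≤ δ₂ / (1 + c * R) := min_le_right _ _
    rw [le_div_iff₀ (by positivity)] at h1
    linarith
  have hnear : ∀ p ∈ Metric.ball (WithLp.toLp 1 (a, b)) η,
      p.fst ∈ V ∧ ‖p.snd - b‖ < η ∧ minimalTime F G p ≠ ⊤ ∧
        (minimalTime F G p).toReal < c * η := by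
    intro p hp
    rw [mem_ball_iff_norm, WithLp.prod_norm_eq_of_L1] at hp
    change ‖p.fst - a‖ + ‖p.snd - b‖ < η at hp
    have h1 := norm_nonneg (p.fst - a)
    have h2 := norm_nonneg (p.snd - b)
    have hpV : p.fst ∈ V := hV (mem_ball_iff_norm.2 (by
      have := min_le_left δ₁ (δ₂ / (1 + c * R))
      linarith))
    obtain ⟨z, hz, hbz⟩ := hGl a (hV (Metric.mem_ball_self hδ₁)) _ hpV b hab
      (hW (Metric.mem_ball_self hδ₂))
    have hmem : 0 + (ℓ + 1) * η / r ∈ reachTimes F (G p.fst) p.snd := by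
      refine add_mem_reachTimes hF hr.le hrF le_rfl (by positivity) (interior_subset hF0) hz ?_
      rw [zero_smul, add_zero, mul_div_cancel₀ _ hr.ne']
      have h3 := norm_sub_le_norm_sub_add_norm_sub z b p.snd
      rw [norm_sub_rev z b, norm_sub_rev b p.snd] at h3
      rw [norm_sub_rev a] at hbz
      have h4 : ℓ * ‖p.fst - a‖ ≤ ℓ * η := mul_le_mul_of_nonneg_left (by linarith) hℓ
      linarith
    refine ⟨hpV, by linarith, minimalTime_ne_top hmem, (toReal_minimalTime_le hmem).trans_lt ?_⟩
    rw [zero_add, hc, div_mul_eq_mul_div]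
    gcongr
    norm_num
  have hone : ∀ p ∈ Metric.ball (WithLp.toLp 1 (a, b)) η,
      ∀ q ∈ Metric.ball (WithLp.toLp 1 (a, b)) η,
        (minimalTime F G q).toReal ≤ (minimalTime F G p).toReal + (ℓ + 1) / r * ‖p - q‖ := by
    intro p hp q hq
    obtain ⟨hpV, hpb, hptop, hplt⟩ := hnear p hp
    obtain ⟨hqV, -⟩ := hnear q hq
    refine le_of_forall_pos_lt_add fun ε hε => ?_
    obtain ⟨t, ⟨ht, f, hf, hz⟩, htlt⟩ := exists_mem_reachTimes_lt hptop
      (lt_min hplt (lt_add_of_pos_right _ hε))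
    obtain ⟨htlt, htε⟩ := lt_min_iff.1 htlt
    have hzW : p.snd + t • f ∈ W := by
      refine hW (mem_ball_iff_norm.2 ?_)
      have h1 : ‖t • f‖ ≤ c * η * R := by
        rw [norm_smul, Real.norm_of_nonneg ht]
        exact mul_le_mul htlt.le (hFR f hf) (norm_nonneg _) (by positivity)
      have h2 := norm_add_le (p.snd - b) (t • f)
      rw [sub_add_eq_add_sub] at h2
      linarith
    obtain ⟨w, hw, hzw⟩ := hGl _ hpV _ hqV _ hz hzW
    have hmem : t + (ℓ + 1) / r * ‖p - q‖ ∈ reachTimes F (G q.fst) q.snd := by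
      refine add_mem_reachTimes hF hr.le hrF ht (by positivity) hf hw ?_
      rw [← mul_assoc, mul_div_cancel₀ _ hr.ne', WithLp.prod_norm_eq_of_L1]
      simp only [WithLp.sub_fst, WithLp.sub_snd]
      have h1 : w - (q.snd + t • f) = (p.snd - q.snd) - (p.snd + t • f - w) := by abel
      have h2 := norm_sub_le (p.snd - q.snd) (p.snd + t • f - w)
      rw [← h1] at h2
      have h3 := mul_nonneg hℓ (norm_nonneg (p.snd - q.snd))
      have h4 := norm_nonneg (p.fst - q.fst)
      linarith
    linarith [toReal_minimalTime_le hmem]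
  refine ⟨(ℓ + 1) / r, _, Metric.ball_mem_nhds _ hηpos,
    fun p hp => ⟨(hnear p hp).2.2.1, minimalTime_ne_bot p⟩, fun p hp q hq => ?_⟩
  have h1 := hone p hp q hq
  have h2 := hone q hq p hp
  rw [norm_sub_rev q p] at h2
  rw [abs_sub_le_iff]
  constructor <;> linarith

end

theorem corollary3p5 (m n : ℕ)
    (F : Set (EuclideanSpace ℝ (Fin n)))
    (hFclosed : IsClosed F) (hFbdd : Bornology.IsBounded F) (hFconv : Convex ℝ F)
    (hF0 : (0 : EuclideanSpace ℝ (Fin n)) ∈ interior F)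
    (G : EuclideanSpace ℝ (Fin m) → Set (EuclideanSpace ℝ (Fin n)))
    (hG : IsClosed (setValuedGraph G))
    (xbar : EuclideanSpace ℝ (Fin m)) (ybar : EuclideanSpace ℝ (Fin n))
    (hxy : (xbar, ybar) ∈ setValuedGraph G) :
    LipschitzAround (minimalTime F G) (WithLp.toLp 1 (xbar, ybar)) ↔
      LipschitzLikeAround G xbar ybar :=
  ⟨fun h => h.lipschitzLikeAround hFbdd (interior_subset hF0),
    fun h => h.lipschitzAround hFbdd hFconv hF0 hxy⟩
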